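/- **Setting.** Let $\Gamma$ be a group of type $F_{n+1}$, $n\ge 0$, and let $X$ be a corresponding complex: a contractible simplicial complex with a free simplicial action of $\Gamma$ and with finitely many orbits of $k$-simplices for each $k\le n+1$ (so that $X/\Gamma$ is an Eilenberg–MacLane space of $\Gamma$ with finite $(n+1)$-skeleton). Fix a set $F$ of simplices of $X$ that contains exactly one translate of every simplex; for a simplex $\sigma$ let $\gamma_\sigma\in\Gamma$ be the unique element with $\gamma_\sigma\sigma\in F$, and $g_\sigma=\gamma_\sigma^{-1}$. Let $S=S^{-1}$ be a finite generating set of $\Gamma$, let $1\le p\le\infty$, and let $\pi$ be a representation of $\Gamma$ by bounded invertible operators on a real or complex Banach space $E$. A representation $\rho$ of $\Gamma$ on $E$ is an *$\varepsilon$-deformation* of $\pi$ if $\sup_{s\in S}\|\pi_s-\rho_s\|\le\varepsilon$. For $k\le n+1$ let $C^k$ be the Banach space of alternating functions $f$ from ordered $k$-simplices of $X$ to $E$ with $f(\sigma)=f(\gamma_\sigma\sigma)$, with the norm $\|f\|=\big(\sum_{\sigma\in F^{(k)}}\|f(\sigma)\|^p\big)^{1/p}$ (the maximum if $p=\infty$),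 where $F^{(k)}$ is the set of $k$-simplices in $F$. For $k\le n$ let $d^k_\pi:C^k\to C^{k+1}$, $$d^k_\pi f(\sigma)=\sum_{i=0}^{k+1}(-1)^i\,\pi_{g_\sigma^{-1}}\pi_{g_{\sigma_i}}f(\sigma_i),$$ where $\sigma_i$ is the $i$-th face of $\sigma$; put $\operatorname{im}d^{-1}_\pi=0$. Then $H^n(\Gamma,\pi)=\ker d^n_\pi/\operatorname{im}d^{n-1}_\pi$, and $H^{n+1}(\Gamma,\pi)$ is *reduced* if $\operatorname{im}d^n_\pi$ equals its closure in $C^{n+1}$. The *$n$-th Kazhdan constant* of $\pi$ is $$\kappa_n(\pi)=\inf_{f\notin\ker d^n_\pi}\frac{\|d^n_\pi f\|}{\inf_{v\in\ker d^n_\pi}\|f+v\|}\in[0,\infty]$$ (with $\inf\emptyset=\infty$ and $c/\infty=0$). A subspace $U$ of a Banach space is *$C$-close* to a subspace $W$ if for every $u\in U$ there is $w\in W$ with $\|u-w\|\le C\|u\|$. **Theorem.** Suppose that $H^n(\Gamma,\pi)=0$ and that $H^{n+1}(\Gamma,\pi)$ is reduced. Then $\kappa_n(\pi)>0$, and there are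 functions $c,C:(0,\infty)\to[0,\infty)$, depending only on $\Gamma,S,X,F,n,p,\pi$, with $c(\varepsilon)\to0$ and $C(\varepsilon)\to 0$ as $\varepsilon\to0^+$, such that for every $\varepsilon>0$ and every $\varepsilon$-deformation $\rho$ of $\pi$: 1. $\|d^n_\pi-d^n_\rho\|\le c(\varepsilon)$, and $\ker d^n_\rho$ is $\dfrac{c(\varepsilon)}{\kappa_n(\pi)}$-close to $\ker d^n_\pi$; 2. $\ker d^n_\pi$ is $C(\varepsilon)$-close to $\ker d^n_\rho$. -/

import Mathlib

open Filter
open scoped ENNReal NNReal Topology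

noncomputable section

/-! ### Geometric realization of an abstract simplicial complex -/

namespace AbstractSimplicialComplex

variable {V : Type*}

/-- The geometric realization: finitely supported barycentric coordinates whose support is a
face. -/
def Realization (K : AbstractSimplicialComplex V) : Type _ :=
  {x : V →₀ ℝ // (∀ v, 0 ≤ x v) ∧ (x.sum fun _ t => t) = 1 ∧ x.support ∈ K.faces}

/-- The closed simplex of the realization which is spanned by the face `σ`. -/
def ClosedSimplex (K : AbstractSimplicialComplex V) (σ : Finset V) : Type _ :=
  {x : K.Realization // x.1.support ⊆ σ}

/-- A closed simplex carries the topology of its barycentric coordinates. -/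
instance (K : AbstractSimplicialComplex V) (σ : Finset V) : TopologicalSpace (K.ClosedSimplex σ) :=
  TopologicalSpace.induced (fun x => (fun v => x.1.1 v : V → ℝ)) inferInstance

/-- The weak topology: a set is open if and only if its trace on every closed simplex is. -/
instance (K : AbstractSimplicialComplex V) : TopologicalSpace K.Realization :=
  ⨆ σ : K.faces, TopologicalSpace.coinduced (fun x : K.ClosedSimplex σ.1 => x.1)
    (inferInstanceAs (TopologicalSpace (K.ClosedSimplex σ.1)))

/-- Ordered `k`-simplices `(v₀, …, vₖ)`: pairwise distinct vertices which span a face. -/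
def Simplex (K : AbstractSimplicialComplex V) (k : ℕ) : Type _ :=
  {v : Fin (k + 1) ↪ V // Finset.univ.map v ∈ K.faces}

namespace Simplex

variable {K : AbstractSimplicialComplex V} {k : ℕ}

/-- The underlying unordered simplex. -/
def support (σ : K.Simplex k) : Finset V := Finset.univ.map σ.1

/-- The ordered simplex `(v_{τ 0}, …, v_{τ k})`. -/
def perm (σ : K.Simplex k) (τ : Equiv.Perm (Fin (k + 1))) : K.Simplex k :=
  ⟨τ.toEmbedding.trans σ.1, by
    have h : Finset.univ.map (τ.toEmbedding.trans σ.1) = Finset.univ.map σ.1 := by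
      rw [← Finset.map_map, Finset.map_univ_equiv]
    rw [h]; exact σ.2⟩

/-- The `i`-th face `(v₀, …, v̂ᵢ, …, v_{k+1})`. -/
def face (σ : K.Simplex (k + 1)) (i : Fin (k + 2)) : K.Simplex k :=
  ⟨(Fin.succAboveEmb i).trans σ.1, by
    refine K.isRelLowerSet_faces.mem_of_le (a := Finset.univ.map σ.1) σ.2 ?_ ?_
    · rw [← Finset.map_map]
      exact Finset.map_subset_map.2 (Finset.subset_univ _)
    · simp⟩

lemma support_perm (σ : K.Simplex k) (τ : Equiv.Perm (Fin (k + 1))) :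
    (σ.perm τ).support = σ.support := by
  unfold support perm
  rw [← Finset.map_map, Finset.map_univ_equiv]

lemma card_support (σ : K.Simplex k) : σ.support.card = k + 1 := by
  simp [support]

lemma support_mem (σ : K.Simplex k) : σ.support ∈ K.faces := σ.2

lemma exists_perm_eq (σ σ' : K.Simplex k) (h : σ.support = σ'.support) :
    ∃ τ, σ = σ'.perm τ := by
  have hr : Set.range σ.1 = Set.range σ'.1 := by
    have := congrArg (fun s : Finset V => (s : Set V)) h
    simpa [support] using this
  have hmem : ∀ i, ∃ j, σ'.1 j = σ.1 i := fun i => by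
    have : σ.1 i ∈ Set.range σ'.1 := hr ▸ Set.mem_range_self i
    exact this
  choose t ht using hmem
  have hinj : Function.Injective t := fun a b hab => σ.1.injective (by rw [← ht a, ← ht b, hab])
  refine ⟨Equiv.ofBijective t (Finite.injective_iff_bijective.1 hinj), ?_⟩
  apply Subtype.ext
  ext i
  exact (ht i).symm

end Simplex

end AbstractSimplicialComplex

/-! ### Complexes witnessing finiteness type `F_N` -/

/-- The translate `g • σ` of a finite set of vertices. -/
def simplexTranslate {Γ V : Type*} [Group Γ] [MulAction Γ V] (g : Γ) (σ : Finset V) : Finset V :=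
  σ.map (MulAction.toPerm g).toEmbedding

/-- A contractible simplicial complex with a free simplicial action of `Γ` and with finitely many
orbits of `k`-simplices for each `k ≤ N`, that is, the universal cover of an Eilenberg–MacLane space
of `Γ` with finite `N`-skeleton. It comes with a fundamental domain `F`, a set of simplices that
contains exactly one translate of every simplex, by exactly one group element; the latter says that
the action is free. -/
structure TypeFComplex (Γ V : Type*) [Group Γ] [MulAction Γ V] (N : ℕ) extends
    AbstractSimplicialComplex V where
  translate_mem : ∀ (g : Γ), ∀ σ ∈ faces, simplexTranslate g σ ∈ faces
  contractible : ContractibleSpace toAbstractSimplicialComplex.Realization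
  F : Set (Finset V)
  F_subset : F ⊆ faces
  F_unique : ∀ σ ∈ faces, ∃! g : Γ, simplexTranslate g σ ∈ F
  F_finite : ∀ k ≤ N, {σ ∈ F | σ.card = k + 1}.Finite

namespace TypeFComplex

variable {Γ V : Type*} [Group Γ] [MulAction Γ V] {N : ℕ} (X : TypeFComplex Γ V N)

/-- Ordered `k`-simplices of `X`. -/
abbrev Simplex (k : ℕ) : Type _ := X.toAbstractSimplicialComplex.Simplex k

variable {k : ℕ}

/-- The translate `g • σ` of an ordered simplex. -/
def smul (g : Γ) (σ : X.Simplex k) : X.Simplex k :=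
  ⟨σ.1.trans (MulAction.toPerm g).toEmbedding, by
    rw [← Finset.map_map]; exact X.translate_mem g _ σ.2⟩

/-- The unique `γ_σ` with `γ_σ • σ ∈ F`. -/
def γ (σ : X.Simplex k) : Γ := (X.F_unique σ.support σ.support_mem).choose

/-- The element `g_σ = γ_σ⁻¹`, so that `σ` lies in `g_σ • F`. -/
def g (σ : X.Simplex k) : Γ := (X.γ σ)⁻¹

/-- The (unordered) `k`-simplices of the fundamental domain. -/
abbrev cells (k : ℕ) : Type _ := {σ : Finset V // σ ∈ X.F ∧ σ.card = k + 1}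

/-- An ordering of the vertices of a simplex of the fundamental domain. The norm of an alternating
function does not depend on it. -/
def ordered (σ : X.cells k) : X.Simplex k :=
  ⟨(σ.1.equivFinOfCardEq σ.2.2).symm.toEmbedding.trans (Function.Embedding.subtype _), by
    have h : Finset.univ.map ((σ.1.equivFinOfCardEq σ.2.2).symm.toEmbedding.trans
        (Function.Embedding.subtype _)) = σ.1 := by
      rw [← Finset.map_map, Finset.map_univ_equiv]
      ext v; simp
    rw [h]; exact X.F_subset σ.2.1⟩

lemma support_ordered (σ : X.cells k) : (X.ordered σ).support = σ.1 := by
  unfold AbstractSimplicialComplex.Simplex.support ordered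
  rw [← Finset.map_map, Finset.map_univ_equiv]
  ext v; simp

lemma support_smul (h : Γ) (σ : X.Simplex k) : (X.smul h σ).support =
    simplexTranslate h σ.support := by
  unfold AbstractSimplicialComplex.Simplex.support smul simplexTranslate
  rw [← Finset.map_map]

lemma translate_γ_mem (σ : X.Simplex k) : simplexTranslate (X.γ σ) σ.support ∈ X.F :=
  (X.F_unique σ.support σ.support_mem).choose_spec.1

lemma γ_eq (σ : X.Simplex k) (h : Γ) (hh : simplexTranslate h σ.support ∈ X.F) : X.γ σ = h :=
  ((X.F_unique σ.support σ.support_mem).choose_spec.2 h hh).symm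

lemma γ_perm (σ : X.Simplex k) (τ : Equiv.Perm (Fin (k + 1))) : X.γ (σ.perm τ) = X.γ σ := by
  apply X.γ_eq
  rw [σ.support_perm]
  exact X.translate_γ_mem σ

lemma γ_smul (h : Γ) (σ : X.Simplex k) : X.γ (X.smul h σ) = X.γ σ * h⁻¹ := by
  apply X.γ_eq
  have : simplexTranslate (X.γ σ * h⁻¹) (X.smul h σ).support =
      simplexTranslate (X.γ σ) σ.support := by
    rw [support_smul]
    unfold simplexTranslate
    rw [Finset.map_map]
    congr 1
    ext v
    simp [mul_smul]
  rw [this]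
  exact X.translate_γ_mem σ

lemma smul_smul (h h' : Γ) (σ : X.Simplex k) : X.smul h (X.smul h' σ) = X.smul (h * h') σ := by
  apply Subtype.ext
  ext i
  simp [smul, mul_smul]

lemma face_smul (h : Γ) (σ : X.Simplex (k + 1)) (i : Fin (k + 2)) :
    (X.smul h σ).face i = X.smul h (σ.face i) := rfl

lemma exists_ordered_perm (σ : X.Simplex k) :
    ∃ (c : X.cells k) (τ : Equiv.Perm (Fin (k + 1))), X.smul (X.γ σ) σ = (X.ordered c).perm τ := by
  have h : (X.smul (X.γ σ) σ).support ∈ X.F := by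
    rw [support_smul]; exact X.translate_γ_mem σ
  refine ⟨⟨_, h, AbstractSimplicialComplex.Simplex.card_support _⟩, ?_⟩
  apply AbstractSimplicialComplex.Simplex.exists_perm_eq
  rw [support_ordered]

/-! ### Cochains -/

variable (𝕜 E : Type*) [RCLike 𝕜] [NormedAddCommGroup E] [NormedSpace 𝕜 E] (p : ℝ≥0∞)

/-- The `p`-summable untwisted cochains: alternating functions `f` on the ordered `k`-simplices with
`f σ = f (γ_σ • σ)` and `∑_{σ ∈ F⁽ᵏ⁾} ‖f σ‖ ^ p < ∞`. -/
def cochains (k : ℕ) : Submodule 𝕜 (X.Simplex k → E) where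
  carrier := {f | (∀ σ τ, f (σ.perm τ) = (Equiv.Perm.sign τ : ℤ) • f σ) ∧
    (∀ σ, f σ = f (X.smul (X.γ σ) σ)) ∧ Memℓp (fun σ : X.cells k => f (X.ordered σ)) p}
  add_mem' := by
    rintro f f' ⟨h1, h2, h3⟩ ⟨h1', h2', h3'⟩
    refine ⟨fun σ τ => ?_, fun σ => ?_, h3.add h3'⟩
    · simp only [Pi.add_apply, h1, h1', smul_add]
    · simp only [Pi.add_apply]; rw [← h2, ← h2']
  zero_mem' := ⟨fun σ τ => by simp, fun σ => rfl, zero_memℓp⟩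
  smul_mem' := by
    rintro c f ⟨h1, h2, h3⟩
    refine ⟨fun σ τ => ?_, fun σ => ?_, h3.const_smul c⟩
    · simp only [Pi.smul_apply, h1]; rw [smul_comm]
    · simp only [Pi.smul_apply]; rw [← h2]

/-- The space `C^k_{(p)}(X, Γ, E)`. -/
def Cochain (k : ℕ) : Type _ := X.cochains 𝕜 E p k

instance : AddCommGroup (X.Cochain 𝕜 E p k) := inferInstanceAs (AddCommGroup (X.cochains 𝕜 E p k))

instance : Module 𝕜 (X.Cochain 𝕜 E p k) := inferInstanceAs (Module 𝕜 (X.cochains 𝕜 E p k))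

/-- Restriction of cochains to the simplices of the fundamental domain. -/
def restrict (k : ℕ) : X.Cochain 𝕜 E p k →ₗ[𝕜] lp (fun _ : X.cells k => E) p where
  toFun f := ⟨fun σ => f.1 (X.ordered σ), f.2.2.2⟩
  map_add' _ _ := rfl
  map_smul' _ _ := rfl

lemma restrict_injective : Function.Injective (X.restrict 𝕜 E p k) := by
  rw [injective_iff_map_eq_zero]
  intro f hf
  apply Subtype.ext
  funext σ
  obtain ⟨c, τ, h⟩ := X.exists_ordered_perm σ
  have hc : f.1 (X.ordered c) = 0 := congrFun (congrArg Subtype.val hf) c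
  rw [f.2.2.1 σ, h, f.2.1, hc, smul_zero]
  rfl

/-- The norm `‖f‖ = (∑_{σ ∈ F⁽ᵏ⁾} ‖f σ‖ ^ p) ^ (1 / p)` (the supremum for `p = ∞`). -/
instance [Fact (1 ≤ p)] : NormedAddCommGroup (X.Cochain 𝕜 E p k) :=
  NormedAddCommGroup.induced _ _ (X.restrict 𝕜 E p k) (X.restrict_injective 𝕜 E p)

instance [Fact (1 ≤ p)] : NormedSpace 𝕜 (X.Cochain 𝕜 E p k) :=
  NormedSpace.induced 𝕜 _ _ (X.restrict 𝕜 E p k)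

/-! ### The twisted codifferential and its cohomology -/

variable {𝕜 E p} (π : Γ →* (E →L[𝕜] E))

/-- The formula `(d_π f)(σ) = ∑ᵢ (-1)ⁱ π(g_σ⁻¹) π(g_{σᵢ}) f(σᵢ)`. -/
def dFun (f : X.Simplex k → E) (σ : X.Simplex (k + 1)) : E :=
  ∑ i : Fin (k + 2), (-1 : ℤ) ^ (i : ℕ) •
    π (X.g σ)⁻¹ (π (X.g (σ.face i)) (f (σ.face i)))

/-- Deleting the `i`-th entry after a permutation of the entries. -/
lemma face_perm (σ : X.Simplex (k + 1)) (τ : Equiv.Perm (Fin (k + 2))) (i : Fin (k + 2)) :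
    ∃ e : Equiv.Perm (Fin (k + 1)), (σ.perm τ).face i = (σ.face (τ i)).perm e ∧
      (-1 : ℤ) ^ (i : ℕ) * (Equiv.Perm.sign e : ℤ) =
        (Equiv.Perm.sign τ : ℤ) * (-1) ^ ((τ i : Fin (k + 2)) : ℕ) := by
  obtain ⟨⟨q, e⟩, hq⟩ := Equiv.Perm.decomposeFin.symm.surjective
    ((i.cycleRange.symm.trans τ).trans (τ i).cycleRange)
  have h0 : q = 0 := by
    have := congrArg (fun μ : Equiv.Perm (Fin (k + 2)) => μ 0) hq
    simpa using this
  subst h0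
  refine ⟨e, ?_, ?_⟩
  · apply Subtype.ext
    ext j
    have hj := congrArg (fun μ : Equiv.Perm (Fin (k + 2)) => μ j.succ) hq
    have hj' : τ (i.succAbove j) = (τ i).succAbove (e j) := by
      rw [← Fin.cycleRange_symm_succ (τ i), ← Fin.cycleRange_symm_succ i, Equiv.eq_symm_apply]
      simpa using hj.symm
    exact congrArg σ.1 hj'
  · have hs := congrArg (fun μ : Equiv.Perm (Fin (k + 2)) => (Equiv.Perm.sign μ : ℤ)) hq
    simp only [Equiv.Perm.decomposeFin.symm_sign, if_true, one_mul, Equiv.Perm.sign_trans,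
      Equiv.Perm.sign_symm, Fin.sign_cycleRange, Units.val_mul, Units.val_pow_eq_pow_val,
      Units.val_neg, Units.val_one] at hs
    rw [hs]
    have h1 : (-1 : ℤ) ^ (i : ℕ) * (-1) ^ (i : ℕ) = 1 := by
      rw [← mul_pow]; simp
    linear_combination ((Equiv.Perm.sign τ : ℤ) * (-1) ^ ((τ i : Fin (k + 2)) : ℕ)) * h1

lemma dFun_mem (hk : k < N) {f : X.Simplex k → E} (hf : f ∈ X.cochains 𝕜 E p k) :
    X.dFun π f ∈ X.cochains 𝕜 E p (k + 1) := by
  obtain ⟨h1, h2, -⟩ := hf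
  have hinv : ∀ (h : Γ) (σ : X.Simplex k), f (X.smul h σ) = f σ := fun h σ => by
    rw [h2 (X.smul h σ), h2 σ, X.γ_smul, X.smul_smul, inv_mul_cancel_right]
  refine ⟨fun σ τ => ?_, fun σ => ?_, ?_⟩
  · unfold dFun
    rw [Finset.smul_sum, ← Equiv.sum_comp τ (fun i => (Equiv.Perm.sign τ : ℤ) •
      (-1 : ℤ) ^ (i : ℕ) • π (X.g σ)⁻¹ (π (X.g (σ.face i)) (f (σ.face i))))]
    refine Finset.sum_congr rfl fun i _ => ?_
    obtain ⟨e, he, hs⟩ := X.face_perm σ τ i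
    have hg : X.g (σ.perm τ) = X.g σ := by unfold g; rw [X.γ_perm]
    have hg' : X.g ((σ.face (τ i)).perm e) = X.g (σ.face (τ i)) := by unfold g; rw [X.γ_perm]
    rw [he, hg, hg', h1, map_zsmul, map_zsmul, ← mul_smul, hs, mul_smul]
  · unfold dFun
    refine Finset.sum_congr rfl fun i _ => ?_
    have key : ∀ (a b : Γ) (x : E), π a (π b x) = π (a * b) x := fun a b x => by
      rw [map_mul]; rfl
    rw [X.face_smul, hinv, key, key]
    congr 3
    simp only [g, X.γ_smul]
    group
  · have : Finite (X.cells (k + 1)) := (X.F_finite (k + 1) hk).to_subtype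
    exact Memℓp.all _

/-- The codifferential `d^k_π` from degree `k` to degree `k + 1`. -/
def d (p : ℝ≥0∞) (k : ℕ) (hk : k < N) : X.Cochain 𝕜 E p k →ₗ[𝕜] X.Cochain 𝕜 E p (k + 1) where
  toFun f := ⟨X.dFun π f.1, X.dFun_mem π hk f.2⟩
  map_add' f f' := by
    apply Subtype.ext
    funext σ
    change X.dFun π (f.1 + f'.1) σ = X.dFun π f.1 σ + X.dFun π f'.1 σ
    simp [dFun, Finset.sum_add_distrib]
  map_smul' c f := by
    apply Subtype.ext
    funext σ
    change X.dFun π (c • f.1) σ = c • X.dFun π f.1 σ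
    simp only [dFun, Pi.smul_apply, map_smul, Finset.smul_sum]
    exact Finset.sum_congr rfl fun i _ => smul_comm _ _ _

/-- The `k`-cocycles `ker d^k_π`. -/
def cocycles (p : ℝ≥0∞) (k : ℕ) (hk : k < N) : Submodule 𝕜 (X.Cochain 𝕜 E p k) :=
  LinearMap.ker (X.d π p k hk)

/-- The `k`-coboundaries `im d^{k-1}_π`, zero for `k = 0`. -/
def coboundaries (p : ℝ≥0∞) : (k : ℕ) → k ≤ N → Submodule 𝕜 (X.Cochain 𝕜 E p k)
  | 0, _ => ⊥
  | k + 1, hk => LinearMap.range (X.d π p k hk)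

/-- The cohomology `H^k(Γ, π) = ker d^k_π / im d^{k-1}_π`, computed on `X`. -/
abbrev Cohomology (p : ℝ≥0∞) (k : ℕ) (hk : k < N) : Type _ :=
  X.cocycles π p k hk ⧸ (X.coboundaries π p k hk.le).submoduleOf (X.cocycles π p k hk)

/-- The cohomology in degree `k` is reduced: dividing by the closure of the coboundaries is the same
as dividing by the coboundaries. -/
def IsReduced (p : ℝ≥0∞) [Fact (1 ≤ p)] (k : ℕ) (hk : k ≤ N) : Prop :=
  closure (X.coboundaries π p k hk : Set (X.Cochain 𝕜 E p k)) = X.coboundaries π p k hk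

/-- The `k`-th Kazhdan constant: the infimum over `f ∉ ker d^k_π` of
`‖d^k_π f‖ / inf_{v ∈ ker d^k_π} ‖f + v‖`, where the infimum over the empty set is `∞`. -/
def kazhdan (p : ℝ≥0∞) [Fact (1 ≤ p)] (k : ℕ) (hk : k < N) : ℝ≥0∞ :=
  ⨅ (f : X.Cochain 𝕜 E p k) (_ : f ∉ X.cocycles π p k hk),
    ‖X.d π p k hk f‖ₑ / ⨅ v : X.cocycles π p k hk, ‖f + v‖ₑ

end TypeFComplex

/-! ### Deformations and close subspaces -/

/-- The distance `d_S(π, ρ) = sup_{s ∈ S} ‖π_s - ρ_s‖` of two representations. -/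
def repDist {Γ 𝕜 E : Type*} [Group Γ] [RCLike 𝕜] [NormedAddCommGroup E] [NormedSpace 𝕜 E]
    (S : Finset Γ) (π ρ : Γ →* (E →L[𝕜] E)) : ℝ :=
  ⨆ s : S, ‖π s - ρ s‖

/-- The representation `ρ` is an `ε`-deformation of `π`, with respect to `S`. -/
def IsDeformation {Γ 𝕜 E : Type*} [Group Γ] [RCLike 𝕜] [NormedAddCommGroup E] [NormedSpace 𝕜 E]
    (S : Finset Γ) (ε : ℝ) (π ρ : Γ →* (E →L[𝕜] E)) : Prop :=
  repDist S π ρ ≤ ε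

/-- The subspace `U` is `C`-close to `W`: every `u ∈ U` admits `w ∈ W` with `‖u - w‖ ≤ C ‖u‖`. -/
def IsClose {𝕜 E : Type*} [RCLike 𝕜] [NormedAddCommGroup E] [NormedSpace 𝕜 E]
    (C : ℝ≥0∞) (U W : Submodule 𝕜 E) : Prop :=
  ∀ u ∈ U, ∃ w ∈ W, ‖u - w‖ₑ ≤ C * ‖u‖ₑ

end

/-! Two facts drive the proof. Each `d` involves only finitely many group elements, because `F` has
finitely many cells in each degree up to `n + 1`; writing these as words in `S` shows that `d_ρ`
tends to `d_π` in operator norm, uniformly over all `ε`-deformations `ρ` (`exists_modulus_d`). And a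
bounded operator between Banach spaces with closed range has preimages of controlled norm, by the
open mapping theorem (`exists_norm_le_of_isClosed_range`).

Reducedness of `H^{n+1}` makes the range of `d^n_π` closed, whence `κ_n(π) > 0`. If `d_ρ u = 0`,
then `‖d_π u‖ ≤ c(ε) ‖u‖`, and the definition of `κ_n` turns this into a bound on the distance from
`u` to `ker d^n_π`.

Conversely, vanishing of `H^n` writes a `π`-cocycle as `u = d^{n-1}_π f` with `‖f‖ ≤ M ‖u‖`. Then
`d^{n-1}_ρ f` is a `ρ`-cocycle near `u`, since `d_ρ ∘ d_ρ = 0`; nothing about the cohomology of `ρ`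
is needed (`exists_modulus_cocycles`). -/

noncomputable section

namespace TypeFComplex

variable {Γ V : Type*} [Group Γ] [MulAction Γ V] {N : ℕ} (X : TypeFComplex Γ V N)

variable {k : ℕ}

lemma finite_cells (hk : k ≤ N) : Finite (X.cells k) := (X.F_finite k hk).to_subtype

variable {𝕜 E : Type*} [RCLike 𝕜] [NormedAddCommGroup E] [NormedSpace 𝕜 E] {p : ℝ≥0∞}

/-! ### The codifferential squares to zero -/

lemma face_face (σ : X.Simplex (k + 2)) (i : Fin (k + 3)) (j : Fin (k + 2)) :
    (σ.face (i.succAbove j)).face (j.predAbove i) = (σ.face i).face j := by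
  apply Subtype.ext
  ext l
  exact congrArg σ.1 (Fin.succAbove_succAbove_succAbove_predAbove i j l)

/-- Untwisting: in terms of `σ ↦ π (g_σ) (f σ)`, the codifferential is the ordinary simplicial
coboundary. -/
lemma rep_g_dFun (π : Γ →* (E →L[𝕜] E)) (f : X.Simplex k → E) (σ : X.Simplex (k + 1)) :
    π (X.g σ) (X.dFun π f σ) =
      ∑ i : Fin (k + 2), (-1 : ℤ) ^ (i : ℕ) • π (X.g (σ.face i)) (f (σ.face i)) := by
  unfold dFun
  rw [map_sum]
  refine Finset.sum_congr rfl fun i _ => ?_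
  rw [map_zsmul, ← mul_apply_eq_comp, ← map_mul, mul_inv_cancel, map_one]
  rfl

lemma dFun_dFun (π : Γ →* (E →L[𝕜] E)) (f : X.Simplex k → E) : X.dFun π (X.dFun π f) = 0 := by
  funext σ
  have h : ∑ i : Fin (k + 3), (-1 : ℤ) ^ (i : ℕ) •
      π (X.g (σ.face i)) (X.dFun π f (σ.face i)) = 0 := by
    simp_rw [X.rep_g_dFun, Finset.smul_sum, _root_.smul_smul, ← pow_add]
    rw [← Finset.sum_product']
    -- The involution exchanges the order in which two vertices are deleted. It keeps the double
    -- face, reverses the sign and has no fixed point.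
    refine Finset.sum_involution (fun a _ => (a.1.succAbove a.2, a.2.predAbove a.1)) ?_ ?_ ?_ ?_
    · rintro ⟨i, j⟩ -
      simp only
      rw [X.face_face, Fin.neg_one_pow_succAbove_add_predAbove, neg_smul, add_neg_cancel]
    · rintro ⟨i, j⟩ - - h
      exact Fin.succAbove_ne i j (congrArg Prod.fst h)
    · simp
    · rintro ⟨i, j⟩ -
      simp [Fin.succAbove_succAbove_predAbove, Fin.predAbove_predAbove_succAbove]
  have h' := congrArg (π (X.g σ)⁻¹) h
  rw [map_sum, map_zero] at h'
  simp_rw [map_zsmul] at h'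
  exact h'

lemma d_d (π : Γ →* (E →L[𝕜] E)) (hk : k < N) (hk' : k + 1 < N) (f : X.Cochain 𝕜 E p k) :
    X.d π p (k + 1) hk' (X.d π p k hk f) = 0 :=
  Subtype.ext (X.dFun_dFun π f.1)

/-! ### The norm of cochains and completeness -/

/-- The representative and the sign depend on `σ` only, not on the cochain, so values on `F` control
all values. -/
lemma cochain_apply_eq (σ : X.Simplex k) : ∃ (c : X.cells k) (u : ℤˣ),
    ∀ f : X.Cochain 𝕜 E p k, f.1 σ = (u : ℤ) • f.1 (X.ordered c) := by
  obtain ⟨c, τ, h⟩ := X.exists_ordered_perm σ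
  exact ⟨c, Equiv.Perm.sign τ, fun f => by rw [f.2.2.1 σ, h, f.2.1]⟩

lemma norm_units_int_smul (u : ℤˣ) (x : E) : ‖(u : ℤ) • x‖ = ‖x‖ := by
  rcases Int.units_eq_one_or u with rfl | rfl <;> simp

variable [Fact (1 ≤ p)]

lemma norm_ordered_le (f : X.Cochain 𝕜 E p k) (c : X.cells k) :
    ‖f.1 (X.ordered c)‖ ≤ ‖f‖ :=
  lp.norm_apply_le_norm (zero_lt_one.trans_le (Fact.out : 1 ≤ p)).ne' (X.restrict 𝕜 E p k f) c

/-- The values of a cochain are bounded by its norm. -/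
lemma norm_apply_le (f : X.Cochain 𝕜 E p k) (σ : X.Simplex k) : ‖f.1 σ‖ ≤ ‖f‖ := by
  obtain ⟨c, u, h⟩ := X.cochain_apply_eq (𝕜 := 𝕜) (E := E) (p := p) σ
  rw [h f, norm_units_int_smul]
  exact X.norm_ordered_le f c

/-- The norm of a cochain is at most the sum of its values on the fundamental domain. -/
lemma norm_le_sum [Fintype (X.cells k)] (f : X.Cochain 𝕜 E p k) :
    ‖f‖ ≤ ∑ c : X.cells k, ‖f.1 (X.ordered c)‖ := by
  classical
  have hp : 0 < p := zero_lt_one.trans_le Fact.out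
  have key : X.restrict 𝕜 E p k f =
      ∑ c : X.cells k, lp.single p c (f.1 (X.ordered c)) := by
    apply Subtype.ext
    rw [lp.coeFn_sum]
    funext c
    rw [Finset.sum_apply, Finset.sum_eq_single c]
    · rw [lp.single_apply_self]; rfl
    · intro b _ hb
      exact lp.single_apply_ne p b _ hb.symm
    · simp
  change ‖X.restrict 𝕜 E p k f‖ ≤ _
  rw [key]
  refine (norm_sum_le _ _).trans (le_of_eq (Finset.sum_congr rfl fun c _ => ?_))
  exact lp.norm_single hp c _

lemma completeSpace_cochain [CompleteSpace E] (hk : k ≤ N) :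
    CompleteSpace (X.Cochain 𝕜 E p k) := by
  have := X.finite_cells hk
  have := Fintype.ofFinite (X.cells k)
  refine Metric.complete_of_cauchySeq_tendsto fun u hu => ?_
  have hc : ∀ σ, ∃ x, Tendsto (fun m => (u m).1 σ) atTop (𝓝 x) := fun σ => by
    refine cauchySeq_tendsto_of_complete (Metric.cauchySeq_iff.2 fun ε hε => ?_)
    obtain ⟨M, hM⟩ := Metric.cauchySeq_iff.1 hu ε hε
    refine ⟨M, fun a ha b hb => ?_⟩
    have h := hM a ha b hb
    rw [dist_eq_norm] at h ⊢
    exact (X.norm_apply_le (u a - u b) σ).trans_lt h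
  choose f hf using hc
  -- Alternation and invariance pass to pointwise limits; summability is automatic on finitely many
  -- cells.
  have hmem : f ∈ X.cochains 𝕜 E p k := by
    refine ⟨fun σ τ => ?_, fun σ => ?_, Memℓp.all _⟩
    · refine tendsto_nhds_unique (hf (σ.perm τ)) ?_
      simp_rw [fun m => (u m).2.1 σ τ]
      exact (hf σ).const_smul _
    · refine tendsto_nhds_unique (hf σ) ?_
      simp_rw [fun m => (u m).2.2.1 σ]
      exact hf _
  refine ⟨⟨f, hmem⟩, tendsto_iff_norm_sub_tendsto_zero.2 ?_⟩
  have hsum : Tendsto (fun m => ∑ c : X.cells k, ‖(u m).1 (X.ordered c) - f (X.ordered c)‖)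
      atTop (𝓝 0) := by
    rw [← Finset.sum_const_zero (s := (Finset.univ : Finset (X.cells k)))]
    exact tendsto_finsetSum _ fun c _ =>
      tendsto_iff_norm_sub_tendsto_zero.1 (hf (X.ordered c))
  exact squeeze_zero (fun _ => norm_nonneg _) (fun m => X.norm_le_sum _) hsum

/-! ### Bounds for the codifferential -/

/-- The group elements that occur in the codifferential on the simplex `c`. -/
def transition (c : X.cells (k + 1)) (i : Fin (k + 2)) : Γ :=
  (X.g (X.ordered c))⁻¹ * X.g ((X.ordered c).face i)

lemma dFun_ordered (π : Γ →* (E →L[𝕜] E)) (f : X.Simplex k → E) (c : X.cells (k + 1)) :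
    X.dFun π f (X.ordered c) = ∑ i : Fin (k + 2), (-1 : ℤ) ^ (i : ℕ) •
      π (X.transition c i) (f ((X.ordered c).face i)) := by
  unfold dFun transition
  simp_rw [map_mul]
  rfl

/-- `A` need not be multiplicative, so that the estimate covers both `π` and the difference `π - ρ`.
The triangle inequality gives a constant valid for every `p`. -/
lemma norm_le_of_ordered_eq [Fintype (X.cells (k + 1))] (A : Γ → (E →L[𝕜] E))
    (f : X.Cochain 𝕜 E p k) (f' : X.Cochain 𝕜 E p (k + 1))
    (h : ∀ c, f'.1 (X.ordered c) = ∑ i : Fin (k + 2), (-1 : ℤ) ^ (i : ℕ) •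
      A (X.transition c i) (f.1 ((X.ordered c).face i))) :
    ‖f'‖ ≤ (∑ c : X.cells (k + 1), ∑ i, ‖A (X.transition c i)‖) * ‖f‖ := by
  refine (X.norm_le_sum f').trans ?_
  rw [Finset.sum_mul]
  refine Finset.sum_le_sum fun c _ => ?_
  rw [h, Finset.sum_mul]
  refine (norm_sum_le _ _).trans (Finset.sum_le_sum fun i _ => ?_)
  have hu := norm_units_int_smul ((-1 : ℤˣ) ^ (i : ℕ))
    (A (X.transition c i) (f.1 ((X.ordered c).face i)))
  push_cast at hu
  rw [hu]
  exact ((A _).le_opNorm _).trans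
    (mul_le_mul_of_nonneg_left (X.norm_apply_le f _) (norm_nonneg _))

lemma norm_d_le [Fintype (X.cells (k + 1))] (π : Γ →* (E →L[𝕜] E)) (hk : k < N)
    (f : X.Cochain 𝕜 E p k) :
    ‖X.d π p k hk f‖ ≤ (∑ c : X.cells (k + 1), ∑ i, ‖π (X.transition c i)‖) * ‖f‖ :=
  X.norm_le_of_ordered_eq (fun h => π h) f _ fun c => X.dFun_ordered π f.1 c

lemma norm_d_sub_d_le [Fintype (X.cells (k + 1))] (π ρ : Γ →* (E →L[𝕜] E)) (hk : k < N)
    (f : X.Cochain 𝕜 E p k) : ‖X.d π p k hk f - X.d ρ p k hk f‖ ≤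
      (∑ c : X.cells (k + 1), ∑ i, ‖π (X.transition c i) - ρ (X.transition c i)‖) * ‖f‖ := by
  refine X.norm_le_of_ordered_eq (fun h => π h - ρ h) f _ fun c => ?_
  change X.dFun π f.1 (X.ordered c) - X.dFun ρ f.1 (X.ordered c) = _
  rw [dFun_ordered, dFun_ordered, ← Finset.sum_sub_distrib]
  refine Finset.sum_congr rfl fun i _ => ?_
  rw [← smul_sub]
  rfl

/-- The codifferential as a bounded operator. -/
def dCLM (π : Γ →* (E →L[𝕜] E)) (p : ℝ≥0∞) [Fact (1 ≤ p)] (k : ℕ) (hk : k < N) :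
    X.Cochain 𝕜 E p k →L[𝕜] X.Cochain 𝕜 E p (k + 1) :=
  haveI := X.finite_cells (k := k + 1) hk
  letI := Fintype.ofFinite (X.cells (k + 1))
  (X.d π p k hk).mkContinuous _ (X.norm_d_le π hk)

@[simp] lemma dCLM_apply (π : Γ →* (E →L[𝕜] E)) (hk : k < N) (f : X.Cochain 𝕜 E p k) :
    X.dCLM π p k hk f = X.d π p k hk f := rfl

lemma isClosed_cocycles (π : Γ →* (E →L[𝕜] E)) (hk : k < N) :
    IsClosed (X.cocycles π p k hk : Set (X.Cochain 𝕜 E p k)) :=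
  (X.dCLM π p k hk).isClosed_ker

end TypeFComplex

/-! ### Deformations -/

section Deformation

variable {Γ 𝕜 E : Type*} [Group Γ] [RCLike 𝕜] [NormedAddCommGroup E] [NormedSpace 𝕜 E]

lemma norm_sub_le_of_isDeformation {S : Finset Γ} {ε : ℝ} {π ρ : Γ →* (E →L[𝕜] E)}
    (h : IsDeformation S ε π ρ) {s : Γ} (hs : s ∈ S) : ‖π s - ρ s‖ ≤ ε :=
  (le_ciSup (f := fun s : S => ‖π s - ρ s‖) (Set.finite_range _).bddAbove ⟨s, hs⟩).trans h

/-- A deformation that is small on a generating set is small at every group element. -/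
lemma exists_modulus_deformation (S : Finset Γ) (hS : Subgroup.closure (S : Set Γ) = ⊤)
    (hS_symm : ∀ s ∈ S, s⁻¹ ∈ S) (π : Γ →* (E →L[𝕜] E)) (h : Γ) :
    ∃ δ : ℝ → ℝ≥0, Tendsto δ (𝓝[>] 0) (𝓝 0) ∧ ∀ ε : ℝ, 0 < ε → ∀ ρ : Γ →* (E →L[𝕜] E),
      IsDeformation S ε π ρ → ‖π h - ρ h‖ ≤ δ ε := by
  have hgen : ∀ s ∈ S, ∃ δ : ℝ → ℝ≥0, Tendsto δ (𝓝[>] 0) (𝓝 0) ∧ ∀ ε : ℝ, 0 < ε →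
      ∀ ρ : Γ →* (E →L[𝕜] E), IsDeformation S ε π ρ → ‖π s - ρ s‖ ≤ δ ε := fun s hs => by
    refine ⟨Real.toNNReal, ?_, fun ε _ ρ hρ =>
      (norm_sub_le_of_isDeformation hρ hs).trans (Real.le_coe_toNNReal ε)⟩
    have := (continuous_real_toNNReal.tendsto 0).mono_left (nhdsWithin_le_nhds (s := Set.Ioi 0))
    simpa using this
  have hh : h ∈ Subgroup.closure (S : Set Γ) := hS ▸ Subgroup.mem_top h
  induction hh using Subgroup.closure_induction'' with
  | mem s hs => exact hgen s hs
  | inv_mem s hs => exact hgen _ (hS_symm s hs)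
  | one => exact ⟨fun _ => 0, tendsto_const_nhds, fun ε _ ρ _ => by simp⟩
  | mul x y _ _ hx hy =>
    obtain ⟨δ, hδ, hδ'⟩ := hx
    obtain ⟨η, hη, hη'⟩ := hy
    -- This comes from `π x π y - ρ x ρ y = π x (π y - ρ y) + (π x - ρ x) ρ y`. Bounding `‖ρ y‖` by
    -- `‖π y‖ + η ε` keeps the modulus independent of `ρ`.
    refine ⟨fun ε => ‖π x‖₊ * η ε + δ ε * (‖π y‖₊ + η ε), ?_, fun ε hε ρ hρ => ?_⟩
    · have := (hη.const_mul ‖π x‖₊).add (hδ.mul (hη.const_add ‖π y‖₊))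
      simpa using this
    · have h1 := hδ' ε hε ρ hρ
      have h2 := hη' ε hε ρ hρ
      have h3 : ‖ρ y‖ ≤ ‖π y‖ + η ε := by
        have := norm_sub_norm_le (ρ y) (π y)
        rw [norm_sub_rev] at this
        linarith
      have h4 : π (x * y) - ρ (x * y) = π x * (π y - ρ y) + (π x - ρ x) * ρ y := by
        rw [map_mul, map_mul]; noncomm_ring
      rw [h4]
      push_cast
      refine (norm_add_le _ _).trans (add_le_add ((norm_mul_le _ _).trans ?_)
        ((norm_mul_le _ _).trans ?_))
      · exact mul_le_mul_of_nonneg_left h2 (norm_nonneg _)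
      · exact mul_le_mul h1 h3 (norm_nonneg _) (NNReal.coe_nonneg _)

/-- The codifferentials of a small deformation are uniformly close to those of `π`. -/
lemma TypeFComplex.exists_modulus_d {V : Type*} [MulAction Γ V] {N : ℕ} (X : TypeFComplex Γ V N)
    (S : Finset Γ) (hS : Subgroup.closure (S : Set Γ) = ⊤) (hS_symm : ∀ s ∈ S, s⁻¹ ∈ S)
    (p : ℝ≥0∞) [Fact (1 ≤ p)] (π : Γ →* (E →L[𝕜] E)) (k : ℕ) (hk : k < N) :
    ∃ c : ℝ → ℝ≥0, Tendsto c (𝓝[>] 0) (𝓝 0) ∧ ∀ ε : ℝ, 0 < ε → ∀ ρ : Γ →* (E →L[𝕜] E),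
      IsDeformation S ε π ρ → ∀ f : X.Cochain 𝕜 E p k,
        ‖X.d π p k hk f - X.d ρ p k hk f‖ ≤ c ε * ‖f‖ := by
  have := X.finite_cells (k := k + 1) hk
  have := Fintype.ofFinite (X.cells (k + 1))
  choose δ hδ hδ' using exists_modulus_deformation S hS hS_symm π
  refine ⟨fun ε => ∑ c : X.cells (k + 1), ∑ i, δ (X.transition c i) ε, ?_, fun ε hε ρ hρ f => ?_⟩
  · have := tendsto_finsetSum (Finset.univ : Finset (X.cells (k + 1))) fun c _ =>
      tendsto_finsetSum Finset.univ fun i _ => hδ (X.transition c i)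
    simpa using this
  · refine (X.norm_d_sub_d_le π ρ hk f).trans (mul_le_mul_of_nonneg_right ?_ (norm_nonneg _))
    push_cast
    exact Finset.sum_le_sum fun c _ => Finset.sum_le_sum fun i _ => hδ' _ ε hε ρ hρ

end Deformation

/-! ### Quantitative consequences of closedness in normed spaces -/

/-- A bounded operator with closed range has preimages of controlled norm. -/
lemma ContinuousLinearMap.exists_norm_le_of_isClosed_range {𝕜 A B : Type*} [RCLike 𝕜]
    [NormedAddCommGroup A] [NormedSpace 𝕜 A] [CompleteSpace A]
    [NormedAddCommGroup B] [NormedSpace 𝕜 B] [CompleteSpace B]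
    (T : A →L[𝕜] B) (hT : IsClosed (LinearMap.range (T : A →ₗ[𝕜] B) : Set B)) :
    ∃ M : ℝ, 0 < M ∧ ∀ x, ∃ y, T y = T x ∧ ‖y‖ ≤ M * ‖T x‖ := by
  -- A closed range is itself a Banach space, so the open mapping theorem applies to the
  -- corestriction of `T`.
  have : CompleteSpace (LinearMap.range (T : A →ₗ[𝕜] B)) := hT.completeSpace_coe
  let T' : A →L[𝕜] LinearMap.range (T : A →ₗ[𝕜] B) := T.codRestrict _ fun x => ⟨x, rfl⟩
  have hsurj : Function.Surjective T' := by
    rintro ⟨_, x, rfl⟩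
    exact ⟨x, rfl⟩
  obtain ⟨M, hM, h⟩ := T'.exists_preimage_norm_le hsurj
  refine ⟨M, hM, fun x => ?_⟩
  obtain ⟨y, hy, hy'⟩ := h (T' x)
  exact ⟨y, congrArg Subtype.val hy, hy'⟩

/-- If `D` bounds the distance from `f` to the closed subspace `K` up to the factor `κ`, and `D` is
at most `c₀ ‖f‖`, then some point of `K` has distance at most `(c / κ) ‖f‖` to `f`, for `c₀ < c`. -/
lemma Submodule.exists_enorm_sub_le {𝕜 A : Type*} [RCLike 𝕜] [NormedAddCommGroup A]
    [NormedSpace 𝕜 A] (K : Submodule 𝕜 A) (hK : IsClosed (K : Set A)) {c₀ c : ℝ≥0} (hc : c₀ < c)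
    {f : A} (hf : f ∉ K) {κ D : ℝ≥0∞} (hκ : κ ≠ 0) (hD : κ ≤ D / ⨅ v : K, ‖f + v‖ₑ)
    (hD_top : D ≠ ∞) (hDf : D ≤ c₀ * ‖f‖ₑ) : ∃ w ∈ K, ‖f - w‖ₑ ≤ c / κ * ‖f‖ₑ := by
  have hI : ⨅ v : K, ‖f + v‖ₑ ≠ 0 := by
    intro h0
    apply hf
    have : f ∈ closure (K : Set A) := by
      rw [EMetric.mem_closure_iff]
      intro ε hε
      obtain ⟨v, hv⟩ := iInf_lt_iff.1 (h0.trans_lt hε)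
      refine ⟨-v, neg_mem v.2, ?_⟩
      rwa [edist_eq_enorm_sub, sub_neg_eq_add]
    rwa [hK.closure_eq] at this
  -- For `κ = ∞` the factor `c / κ` would be `0` and force `f ∈ K`; this is excluded because `D` is
  -- finite and the distance from `f` to `K` is not zero.
  have hκ_top : κ ≠ ∞ := (hD.trans_lt (ENNReal.div_lt_top hD_top hI)).ne
  have hf_pos : ‖f‖ₑ ≠ 0 := by
    rw [enorm_ne_zero]
    rintro rfl
    exact hf (zero_mem _)
  have h1 : (⨅ v : K, ‖f + v‖ₑ) * κ < c * ‖f‖ₑ := by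
    calc (⨅ v : K, ‖f + v‖ₑ) * κ ≤ D := by
          rw [mul_comm]; exact ENNReal.mul_le_of_le_div hD
      _ ≤ c₀ * ‖f‖ₑ := hDf
      _ < c * ‖f‖ₑ := ENNReal.mul_lt_mul_left hf_pos enorm_ne_top (ENNReal.coe_lt_coe.2 hc)
  -- The strict inequality, gained from `c₀ < c` and `f ≠ 0`, yields an actual point of `K` even if
  -- the infimum is not attained.
  have h2 : ⨅ v : K, ‖f + v‖ₑ < c / κ * ‖f‖ₑ := by
    rw [ENNReal.div_eq_inv_mul, mul_assoc, ← ENNReal.div_eq_inv_mul]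
    exact (ENNReal.lt_div_iff_mul_lt (Or.inl hκ) (Or.inl hκ_top)).2 h1
  obtain ⟨v, hv⟩ := iInf_lt_iff.1 h2
  exact ⟨-v, neg_mem v.2, by rw [sub_neg_eq_add]; exact hv.le⟩

namespace TypeFComplex

variable {Γ V : Type*} [Group Γ] [MulAction Γ V] {N : ℕ} (X : TypeFComplex Γ V N)
  {𝕜 E : Type*} [RCLike 𝕜] [NormedAddCommGroup E] [NormedSpace 𝕜 E]
  (π : Γ →* (E →L[𝕜] E)) {p : ℝ≥0∞} {k : ℕ} (hk : k < N)

/-- Vanishing cohomology: every cocycle is a coboundary. -/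
lemma cocycles_le_coboundaries (h : Subsingleton (X.Cohomology π p k hk)) :
    X.cocycles π p k hk ≤ X.coboundaries π p k hk.le := by
  rw [Submodule.Quotient.subsingleton_iff, Submodule.submoduleOf_eq_top] at h
  exact h

variable [Fact (1 ≤ p)]

lemma exists_norm_le_of_isClosed_range [CompleteSpace E]
    (h : IsClosed (LinearMap.range (X.d π p k hk) : Set (X.Cochain 𝕜 E p (k + 1)))) :
    ∃ M : ℝ, 0 < M ∧ ∀ f : X.Cochain 𝕜 E p k, ∃ f', X.d π p k hk f' = X.d π p k hk f ∧
      ‖f'‖ ≤ M * ‖X.d π p k hk f‖ := by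
  have := X.completeSpace_cochain (𝕜 := 𝕜) (E := E) (p := p) hk.le
  have := X.completeSpace_cochain (𝕜 := 𝕜) (E := E) (p := p) (k := k + 1) hk
  exact (X.dCLM π p k hk).exists_norm_le_of_isClosed_range h

/-! ### The Kazhdan constant -/

/-- If the image of the codifferential is closed then the Kazhdan constant is positive. -/
lemma kazhdan_pos [CompleteSpace E]
    (h : IsClosed (LinearMap.range (X.d π p k hk) : Set (X.Cochain 𝕜 E p (k + 1)))) :
    0 < X.kazhdan π p k hk := by
  obtain ⟨M, hM, hf⟩ := X.exists_norm_le_of_isClosed_range π hk h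
  have hM' : 0 < (ENNReal.ofReal M)⁻¹ := ENNReal.inv_pos.2 ENNReal.ofReal_ne_top
  -- The constant `1 / M` is a lower bound: replacing `f` by a controlled preimage `f'` of `d f`
  -- changes it by a cocycle, so the distance from `f` to the cocycles is at most `‖f'‖ ≤ M ‖d f‖`.
  refine hM'.trans_le (le_iInf₂ fun f hf0 => ?_)
  obtain ⟨f', h1, h2⟩ := hf f
  have hv : f' - f ∈ X.cocycles π p k hk := by
    rw [cocycles, LinearMap.mem_ker, map_sub, h1, sub_self]
  have hd : ‖X.d π p k hk f‖ₑ ≠ 0 := by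
    rw [enorm_ne_zero]
    exact hf0
  have hle : ⨅ v : X.cocycles π p k hk, ‖f + v‖ₑ ≤ ENNReal.ofReal M * ‖X.d π p k hk f‖ₑ := by
    refine (iInf_le _ ⟨f' - f, hv⟩).trans ?_
    rw [add_sub_cancel, ← ofReal_norm, ← ofReal_norm, ← ENNReal.ofReal_mul hM.le]
    exact ENNReal.ofReal_le_ofReal h2
  calc (ENNReal.ofReal M)⁻¹
      = ‖X.d π p k hk f‖ₑ / (ENNReal.ofReal M * ‖X.d π p k hk f‖ₑ) := by
        rw [mul_comm, ENNReal.div_eq_inv_mul, ENNReal.mul_inv (Or.inl hd) (Or.inl enorm_ne_top),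
          mul_right_comm, ENNReal.inv_mul_cancel hd enorm_ne_top, one_mul]
    _ ≤ _ := ENNReal.div_le_div_left hle _

/-- A cochain with small codifferential is close to a cocycle. -/
lemma exists_cocycle_enorm_sub_le {c₀ c : ℝ≥0} (hc : c₀ < c) (hκ : 0 < X.kazhdan π p k hk)
    (f : X.Cochain 𝕜 E p k) (hf : ‖X.d π p k hk f‖ ≤ c₀ * ‖f‖) :
    ∃ w ∈ X.cocycles π p k hk, ‖f - w‖ₑ ≤ c / X.kazhdan π p k hk * ‖f‖ₑ := by
  by_cases hf0 : f ∈ X.cocycles π p k hk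
  · exact ⟨f, hf0, by simp⟩
  have hdf : ‖X.d π p k hk f‖ₑ ≤ c₀ * ‖f‖ₑ := by
    rw [← ofReal_norm, ← ofReal_norm f, ← ENNReal.ofReal_coe_nnreal,
      ← ENNReal.ofReal_mul c₀.coe_nonneg]
    exact ENNReal.ofReal_le_ofReal hf
  exact (X.cocycles π p k hk).exists_enorm_sub_le (X.isClosed_cocycles π hk) hc hf0 hκ.ne'
    (iInf₂_le f hf0) enorm_ne_top hdf

/-! ### Approximating cocycles of `π` by cocycles of `ρ` -/

/-- If the cohomology of `π` vanishes, its cocycles are close to those of a small deformation. -/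
lemma exists_modulus_cocycles [CompleteSpace E] (S : Finset Γ)
    (hS : Subgroup.closure (S : Set Γ) = ⊤) (hS_symm : ∀ s ∈ S, s⁻¹ ∈ S)
    (h : Subsingleton (X.Cohomology π p k hk)) :
    ∃ C : ℝ → ℝ≥0, Tendsto C (𝓝[>] 0) (𝓝 0) ∧ ∀ ε : ℝ, 0 < ε → ∀ ρ : Γ →* (E →L[𝕜] E),
      IsDeformation S ε π ρ → IsClose (C ε) (X.cocycles π p k hk) (X.cocycles ρ p k hk) := by
  have hle := X.cocycles_le_coboundaries π hk h
  match k, hk, hle with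
  -- In degree `0` the coboundaries are zero, so `π` has no nonzero cocycles.
  | 0, hk, hle =>
    refine ⟨fun _ => 0, tendsto_const_nhds, fun ε _ ρ _ u hu => ⟨0, zero_mem _, ?_⟩⟩
    have hu0 : u = 0 := hle hu
    simp [hu0]
  | m + 1, hk, hle =>
    have hm : m < N := (Nat.lt_succ_self m).trans hk
    -- The range of the lower codifferential is a kernel and therefore closed; reducedness in this
    -- degree comes for free.
    have hrange : LinearMap.range (X.d π p m hm) = X.cocycles π p (m + 1) hk := by
      refine le_antisymm ?_ hle
      rintro _ ⟨f, rfl⟩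
      exact X.d_d π hm hk f
    obtain ⟨M, hM, hf⟩ := X.exists_norm_le_of_isClosed_range π hm
      (hrange ▸ X.isClosed_cocycles π hk)
    obtain ⟨c, hc, hc'⟩ := X.exists_modulus_d S hS hS_symm p π m hm
    refine ⟨fun ε => c ε * M.toNNReal, by simpa using hc.mul_const M.toNNReal,
      fun ε hε ρ hρ u hu => ?_⟩
    obtain ⟨f₀, rfl⟩ := hle hu
    obtain ⟨f, h1, h2⟩ := hf f₀
    -- Apply `d_ρ` to the controlled `d_π`-primitive `f` of `u`: the error `(d_π - d_ρ) f` is at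
    -- most `c ε * ‖f‖ ≤ c ε * M * ‖u‖`.
    refine ⟨X.d ρ p m hm f, X.d_d ρ hm hk f, ?_⟩
    rw [← h1] at h2 ⊢
    have h3 : ‖X.d π p m hm f - X.d ρ p m hm f‖ ≤
        ((c ε * M.toNNReal : ℝ≥0) : ℝ) * ‖X.d π p m hm f‖ := by
      refine (hc' ε hε ρ hρ f).trans ?_
      rw [NNReal.coe_mul, Real.coe_toNNReal M hM.le, mul_assoc]
      exact mul_le_mul_of_nonneg_left h2 (NNReal.coe_nonneg _)
    rw [← ofReal_norm, ← ofReal_norm (X.d π p m hm f), ← ENNReal.ofReal_coe_nnreal,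
      ← ENNReal.ofReal_mul (NNReal.coe_nonneg _)]
    exact ENNReal.ofReal_le_ofReal h3

end TypeFComplex

end

theorem mainTheorem5 {Γ V 𝕜 E : Type*} [Group Γ] [MulAction Γ V] [RCLike 𝕜]
    [NormedAddCommGroup E] [NormedSpace 𝕜 E] [CompleteSpace E]
    (n : ℕ) (X : TypeFComplex Γ V (n + 1))
    (S : Finset Γ) (hS : Subgroup.closure (S : Set Γ) = ⊤) (hS_symm : ∀ s ∈ S, s⁻¹ ∈ S)
    (p : ℝ≥0∞) [Fact (1 ≤ p)]
    (π : Γ →* (E →L[𝕜] E))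
    (h_vanish : Subsingleton (X.Cohomology π p n (Nat.lt_succ_self n)))
    (h_reduced : X.IsReduced π p (n + 1) le_rfl) :
    0 < X.kazhdan π p n (Nat.lt_succ_self n) ∧
    ∃ c C : ℝ → ℝ≥0, Tendsto c (𝓝[>] 0) (𝓝 0) ∧ Tendsto C (𝓝[>] 0) (𝓝 0) ∧
      ∀ ε : ℝ, 0 < ε → ∀ ρ : Γ →* (E →L[𝕜] E), IsDeformation S ε π ρ →
        (∀ f : X.Cochain 𝕜 E p n, ‖X.d π p n (Nat.lt_succ_self n) f -
          X.d ρ p n (Nat.lt_succ_self n) f‖ ≤ c ε * ‖f‖) ∧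
        IsClose (c ε / X.kazhdan π p n (Nat.lt_succ_self n))
          (X.cocycles ρ p n (Nat.lt_succ_self n)) (X.cocycles π p n (Nat.lt_succ_self n)) ∧
        IsClose (C ε)
          (X.cocycles π p n (Nat.lt_succ_self n)) (X.cocycles ρ p n (Nat.lt_succ_self n)) := by
  have hclosed : IsClosed (LinearMap.range (X.d π p n (Nat.lt_succ_self n)) :
      Set (X.Cochain 𝕜 E p (n + 1))) := closure_eq_iff_isClosed.1 h_reduced
  have hκ := X.kazhdan_pos π (Nat.lt_succ_self n) hclosed
  obtain ⟨c, hc, hc'⟩ := X.exists_modulus_d S hS hS_symm p π n (Nat.lt_succ_self n)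
  obtain ⟨C, hC, hC'⟩ := X.exists_modulus_cocycles π (Nat.lt_succ_self n) S hS hS_symm h_vanish
  have hid : Tendsto Real.toNNReal (𝓝[>] 0) (𝓝 0) := by
    simpa using (continuous_real_toNNReal.tendsto 0).mono_left
      (nhdsWithin_le_nhds (s := Set.Ioi 0))
  -- The summand `ε` gives room, as the distance to the cocycles need not be attained.
  refine ⟨hκ, fun ε => c ε + ε.toNNReal, C, by simpa using hc.add hid, hC,
    fun ε hε ρ hρ => ⟨fun f => ?_, fun u hu => ?_, hC' ε hε ρ hρ⟩⟩
  · refine (hc' ε hε ρ hρ f).trans (mul_le_mul_of_nonneg_right ?_ (norm_nonneg _))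
    exact NNReal.coe_le_coe.2 le_self_add
  · have hu0 : X.d ρ p n (Nat.lt_succ_self n) u = 0 := hu
    have hdu := hc' ε hε ρ hρ u
    -- As `u` is a `ρ`-cocycle, the bound on `d_π - d_ρ` is a bound on `d_π u` itself.
    rw [hu0, sub_zero] at hdu
    exact X.exists_cocycle_enorm_sub_le π (Nat.lt_succ_self n)
      (lt_add_of_pos_right _ (Real.toNNReal_pos.2 hε)) hκ u hdu
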